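/- Let $n\ge 1$, let $I\subseteq\mathbb R$ be an open interval, and let $f:I\to\mathbb R$ be $2n$ times continuously differentiable. For points $x_0,\dots,x_k\in I$ ($k\le 2n$), not necessarily distinct, let $[x_0,\dots,x_k]_f$ denote the divided difference of $f$, extended by continuity to coincident points. Call $f$ *$n$-convex* in an open interval $J\subseteq I$ if $$f(\lambda A+(1-\lambda)B)\le\lambda f(A)+(1-\lambda)f(B)$$ (in the positive semidefinite order) for all $\lambda\in[0,1]$ and all complex Hermitian $n\times n$ matrices $A,B$ with spectra in $J$. 1. For all $s,t_1,\dots,t_n\in I$ and $r=1,\dots,n$, the leading Kraus determinants $D_r(s)=\det\big([t_i,s,t_j]_f\big)_{i,j=1}^r$ satisfy $$D_r(s)=\det M_r\cdot\prod_{k=1}^{r-1}\prod_{l=1}^{r-k}(t_{k+l}-t_l)^2,\qquad M_r=\big([t_1,\dots,t_i,s,t_1,\dots,t_j]_f\big)_{i,j=1}^r .$$ 2. If $f$ is $n$-convex in $I$, then the matrix $$K_n(f;t)=\left(\frac{f^{(i+j)}(t)}{(i+j)!}\right)_{i,j=1}^n$$ is positive semidefinite for every $t\in I$. 3. Conversely,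 if $K_n(f;t_0)$ is positive definite for some $t_0\in I$, then $f$ is $n$-convex in some open interval $J$ with $t_0\in J\subseteq I$. -/

import Mathlib

open scoped ComplexOrder

/-- The divided difference `[x₀, x₁, …, x_k]_f` of a list of points, which may coincide:
`[x₀]_f = f x₀` and `[x₀, x₁, …, x_k]_f = [x₁, …, x_k]_g`, where `g = dslope f x₀` is the
difference quotient `y ↦ (f y - f x₀) / (y - x₀)`, extended to `y = x₀` by its limit `f' x₀`.
If `f` is `C^k` on an open interval containing the points, then this is the usual divided
difference: it is symmetric and continuous in the points, it satisfies
`(y - x) [x, l, y]_f = [l, y]_f - [x, l]_f`, and `[x, …, x]_f = f⁽ᵏ⁾(x) / k!`.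
The value at the empty list is a dummy. -/
noncomputable def divDiff : (ℝ → ℝ) → List ℝ → ℝ
  | _, [] => 0
  | f, [x] => f x
  | f, x :: y :: l => divDiff (dslope f x) (y :: l)

/-- `f` is `n`-convex in `I`: `f (λ A + (1 - λ) B) ≤ λ f(A) + (1 - λ) f(B)` in the Loewner order
for all complex Hermitian `n × n` matrices `A`, `B` with spectra in `I` and all `λ ∈ [0, 1]`.
Here `f(A)` is the functional calculus (the spectrum of a matrix is finite, hence discrete, so that
no continuity of `f` is needed for it). -/
def IsMatrixConvexOn (n : ℕ) (I : Set ℝ) (f : ℝ → ℝ) : Prop :=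
  ∀ A B : Matrix (Fin n) (Fin n) ℂ, A.IsHermitian → B.IsHermitian →
    spectrum ℝ A ⊆ I → spectrum ℝ B ⊆ I → ∀ c : ℝ, c ∈ Set.Icc (0 : ℝ) 1 →
      (c • cfc f A + (1 - c) • cfc f B - cfc f (c • A + (1 - c) • B)).PosSemidef

/-- The leading Kraus determinant `D_r(s) = det ([t_i, s, t_j]_f)`, `i, j = 1, …, r`. -/
noncomputable def krausDet (f : ℝ → ℝ) (t : ℕ → ℝ) (r : ℕ) (s : ℝ) : ℝ :=
  (Matrix.of fun i j : Fin r => divDiff f [t (i + 1), s, t (j + 1)]).det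

/-- The list `t_1, …, t_i`. -/
def initialPoints (t : ℕ → ℝ) (i : ℕ) : List ℝ :=
  (List.range i).map fun k => t (k + 1)

/-- The matrix `M_r` with entries `[t_1, …, t_i, s, t_1, …, t_j]_f`, `i, j = 1, …, r`. -/
noncomputable def krausM (f : ℝ → ℝ) (t : ℕ → ℝ) (r : ℕ) (s : ℝ) : Matrix (Fin r) (Fin r) ℝ :=
  Matrix.of fun i j => divDiff f (initialPoints t (i + 1) ++ s :: initialPoints t (j + 1))

/-- The matrix `K_n(f; t)` with entries `f^(i+j)(t) / (i+j)!`, `i, j = 1, …, n`. -/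
noncomputable def hankelK (n : ℕ) (f : ℝ → ℝ) (t : ℝ) : Matrix (Fin n) (Fin n) ℝ :=
  Matrix.of fun i j =>
    iteratedDeriv ((i + 1) + (j + 1)) f t / (Nat.factorial ((i + 1) + (j + 1)) : ℝ)

/-!
The link between the three parts is Newton interpolation. As a function of its last point a divided
difference is an iterated difference quotient, so expanding `[t_i, s, t_j]_f` by Newton's formula in
both outer points gives the factorization `C M_r Cᵀ` of the Kraus matrix (`krausMatrix_eq`), where
`C` is the lower triangular matrix of the values of the Newton polynomials at the nodes. Taking
determinants yields the product formula, for coincident points as well. What has to be known about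
divided differences is that they are symmetric (`divDiff_perm`) and, near a point `t`, close to the
Taylor coefficients at `t` (`exists_divDiff_near`). Both rest on the integral formula
`dslope f x y = ∫₀¹ f'(x + u (y - x)) du` and its derivatives.

The link with matrix convexity is the second derivative of `h ↦ f(C + h X)` at `C = diag(c)`, whose
entries are `2 ∑ₖ [c_j, c_k, c_i]_f X_ik X_kj` (`tendsto_cfc_second_difference`). It comes from the
identity `f(A) - f(c) = [c, ·]_f(A) (A - c)`, applied columnwise with `c = c_j`: it expresses second
differences of `f` by first differences of `[c_j, ·]_f`, and these by values of `[c_j, c_k, ·]_f`, for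
which continuity of the functional calculus suffices. No differentiability of matrix functions
beyond these limits is used.

If `f` is `n`-convex, then a choice of `X` concentrated in one row and column shows that the Kraus
matrix at `s = t_k` is positive semidefinite (`IsMatrixConvexOn.posSemidef_krausMatrix`). For distinct
nodes `C` is invertible, hence `M_n` is positive semidefinite, and letting all nodes tend to `t` gives
the Hankel matrix `K_n(f; t)`. Conversely, if `K_n(f; t₀)` is positive definite, then `M_n` is positive
semidefinite for all points near `t₀`, hence so are the Kraus matrices. After diagonalization this
says that `τ ↦ ⟨v, f(τ A + (1 - τ) B) v⟩` has a nonnegative symmetric second derivative, so this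
function is convex (`isMatrixConvexOn_of_posSemidef_krausMatrix`).
-/

open Set Filter Topology intervalIntegral

/-! ### Regularity of difference quotients -/

theorem add_mul_sub_mem {I : Set ℝ} (hI : I.OrdConnected) {x y u : ℝ} (hx : x ∈ I) (hy : y ∈ I)
    (hu : u ∈ Icc (0 : ℝ) 1) : x + u * (y - x) ∈ I := by
  have := hI.convex.add_smul_sub_mem hx hy hu
  simpa using this

theorem continuousOn_comp_segment {I : Set ℝ} (hI : I.OrdConnected) {φ : ℝ → ℝ}
    (hφ : ContinuousOn φ I) (k : ℕ) {x y : ℝ} (hx : x ∈ I) (hy : y ∈ I) :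
    ContinuousOn (fun u => u ^ k * φ (x + u * (y - x))) (uIcc 0 1) := by
  refine (continuous_pow k).continuousOn.mul (hφ.comp (by fun_prop) ?_)
  intro u hu
  rw [uIcc_of_le zero_le_one] at hu
  exact add_mul_sub_mem hI hx hy hu

/-- A bound for the integrand `u ^ k * ψ (x + u * (z - x))` that is uniform for `z` near `y`, as the
theorems on parametric integrals require. -/
theorem exists_bound_segment {I : Set ℝ} (hIo : IsOpen I) (hI : I.OrdConnected) {ψ : ℝ → ℝ}
    (hψ : ContinuousOn ψ I) (k : ℕ) {x y : ℝ} (hx : x ∈ I) (hy : y ∈ I) :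
    ∃ B, ∃ s ∈ 𝓝 y, s ⊆ I ∧
      ∀ z ∈ s, ∀ u ∈ Icc (0 : ℝ) 1, ‖u ^ k * ψ (x + u * (z - x))‖ ≤ B := by
  obtain ⟨δ, hδ, hball⟩ := Metric.nhds_basis_closedBall.mem_iff.mp (hIo.mem_nhds hy)
  rw [Real.closedBall_eq_Icc] at hball
  have hyl : y - δ ∈ I := hball ⟨le_rfl, by linarith⟩
  have hyr : y + δ ∈ I := hball ⟨by linarith, le_rfl⟩
  have hK : Icc (min x (y - δ)) (max x (y + δ)) ⊆ I := by
    refine hI.out ?_ ?_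
    · rcases min_choice x (y - δ) with h | h <;> rw [h] <;> assumption
    · rcases max_choice x (y + δ) with h | h <;> rw [h] <;> assumption
  obtain ⟨B, hB⟩ := isCompact_Icc.exists_bound_of_continuousOn (hψ.mono hK)
  refine ⟨B, Icc (y - δ) (y + δ), Icc_mem_nhds (by linarith) (by linarith), hball, ?_⟩
  intro z hz u hu
  have hmem : x + u * (z - x) ∈ Icc (min x (y - δ)) (max x (y + δ)) :=
    add_mul_sub_mem ordConnected_Icc ⟨min_le_left _ _, le_max_left _ _⟩
      ⟨(min_le_right _ _).trans hz.1, hz.2.trans (le_max_right _ _)⟩ hu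
  have h1 : ‖u ^ k‖ ≤ 1 := by
    rw [Real.norm_of_nonneg (pow_nonneg hu.1 _)]
    exact pow_le_one₀ hu.1 hu.2
  calc ‖u ^ k * ψ (x + u * (z - x))‖
      = ‖u ^ k‖ * ‖ψ (x + u * (z - x))‖ := norm_mul _ _
    _ ≤ 1 * B := mul_le_mul h1 (hB _ hmem) (norm_nonneg _) zero_le_one
    _ = B := one_mul B

theorem mem_Icc_of_mem_uIoc {u : ℝ} (hu : u ∈ uIoc (0 : ℝ) 1) : u ∈ Icc (0 : ℝ) 1 := by
  rw [uIoc_of_le zero_le_one] at hu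
  exact Ioc_subset_Icc_self hu

theorem aestronglyMeasurable_segment {I : Set ℝ} (hI : I.OrdConnected) {φ : ℝ → ℝ}
    (hφ : ContinuousOn φ I) (k : ℕ) {x y : ℝ} (hx : x ∈ I) (hy : y ∈ I) :
    MeasureTheory.AEStronglyMeasurable (fun u => u ^ k * φ (x + u * (y - x)))
      (MeasureTheory.volume.restrict (uIoc 0 1)) :=
  (intervalIntegrable_iff.mp
    (continuousOn_comp_segment hI hφ k hx hy).intervalIntegrable).aestronglyMeasurable

theorem continuousAt_integral_segment {I : Set ℝ} (hIo : IsOpen I) (hI : I.OrdConnected)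
    {φ : ℝ → ℝ} (hφ : ContinuousOn φ I) (k : ℕ) {x y : ℝ} (hx : x ∈ I) (hy : y ∈ I) :
    ContinuousAt (fun y => ∫ u in (0 : ℝ)..1, u ^ k * φ (x + u * (y - x))) y := by
  obtain ⟨B, s, hs, -, hB⟩ := exists_bound_segment hIo hI hφ k hx hy
  refine continuousAt_of_dominated_interval (bound := fun _ => B) ?_ ?_ (by simp) ?_
  · filter_upwards [hIo.mem_nhds hy] with z hz using aestronglyMeasurable_segment hI hφ k hx hz
  · filter_upwards [hs] with z hz
    exact .of_forall fun u hu => hB z hz u (mem_Icc_of_mem_uIoc hu)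
  · refine .of_forall fun u hu => ?_
    have hm := add_mul_sub_mem hI hx hy (mem_Icc_of_mem_uIoc hu)
    exact continuousAt_const.mul (ContinuousAt.comp (f := fun z => x + u * (z - x))
      (hφ.continuousAt (hIo.mem_nhds hm)) (by fun_prop))

theorem hasDerivAt_integral_segment {I : Set ℝ} (hIo : IsOpen I) (hI : I.OrdConnected)
    {φ φ' : ℝ → ℝ} (hφ : ∀ z ∈ I, HasDerivAt φ (φ' z) z) (hφ' : ContinuousOn φ' I) (k : ℕ)
    {x y : ℝ} (hx : x ∈ I) (hy : y ∈ I) :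
    HasDerivAt (fun y => ∫ u in (0 : ℝ)..1, u ^ k * φ (x + u * (y - x)))
      (∫ u in (0 : ℝ)..1, u ^ (k + 1) * φ' (x + u * (y - x))) y := by
  have hφc : ContinuousOn φ I := fun z hz => (hφ z hz).continuousAt.continuousWithinAt
  obtain ⟨B, s, hs, hsI, hB⟩ := exists_bound_segment hIo hI hφ' (k + 1) hx hy
  refine (hasDerivAt_integral_of_dominated_loc_of_deriv_le
    (F' := fun y u => u ^ (k + 1) * φ' (x + u * (y - x))) (bound := fun _ => B) hs ?_
    (continuousOn_comp_segment hI hφc k hx hy).intervalIntegrable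
    (aestronglyMeasurable_segment hI hφ' (k + 1) hx hy) ?_ (by simp) ?_).2
  · filter_upwards [hIo.mem_nhds hy] with z hz using aestronglyMeasurable_segment hI hφc k hx hz
  · exact .of_forall fun u hu z hz => hB z hz u (mem_Icc_of_mem_uIoc hu)
  · refine .of_forall fun u hu z hz => ?_
    have h1 : HasDerivAt (fun z : ℝ => x + u * (z - x)) u z := by
      simpa using (((hasDerivAt_id z).sub_const x).const_mul u).const_add x
    have h2 := ((hφ _ (add_mul_sub_mem hI hx (hsI hz) (mem_Icc_of_mem_uIoc hu))).comp z
      h1).const_mul (u ^ k)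
    exact h2.congr_deriv (by ring)

/-- A difference quotient is the mean of the derivative over the segment. In contrast to the quotient
itself, this formula is uniform in `y`, including `y = x`. -/
theorem dslope_eq_integral {I : Set ℝ} (hIo : IsOpen I) (hI : I.OrdConnected) {f : ℝ → ℝ}
    (hf : ContDiffOn ℝ 1 f I) {x y : ℝ} (hx : x ∈ I) (hy : y ∈ I) :
    dslope f x y = ∫ u in (0 : ℝ)..1, deriv f (x + u * (y - x)) := by
  rcases eq_or_ne y x with rfl | hne
  · simp
  have hd : ContinuousOn (deriv f) I := hf.continuousOn_deriv_of_isOpen hIo le_rfl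
  have hderiv : ∀ u ∈ uIcc (0 : ℝ) 1,
      HasDerivAt (fun u => f (x + u * (y - x))) (deriv f (x + u * (y - x)) * (y - x)) u := by
    intro u hu
    rw [uIcc_of_le zero_le_one] at hu
    have hm := add_mul_sub_mem hI hx hy hu
    have h1 : HasDerivAt (fun u : ℝ => x + u * (y - x)) (y - x) u := by
      simpa using ((hasDerivAt_id u).mul_const (y - x)).const_add x
    exact (((hf.differentiableOn one_ne_zero).differentiableAt (hIo.mem_nhds hm)).hasDerivAt).comp
      u h1
  have hint : ContinuousOn (fun u => deriv f (x + u * (y - x))) (uIcc 0 1) := by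
    simpa using continuousOn_comp_segment hI hd 0 hx hy
  have := integral_eq_sub_of_hasDerivAt hderiv
    ((hint.mul continuousOn_const).intervalIntegrable)
  rw [integral_mul_const] at this
  have hyx : y - x ≠ 0 := sub_ne_zero.mpr hne
  rw [dslope_of_ne f hne, slope_def_field, div_eq_iff hyx, this]
  simp

theorem continuousOn_iteratedDeriv {I : Set ℝ} (hIo : IsOpen I) {N k : ℕ} {f : ℝ → ℝ}
    (hf : ContDiffOn ℝ N f I) (hk : k ≤ N) : ContinuousOn (iteratedDeriv k f) I :=
  (hf.continuousOn_iteratedDerivWithin (by exact_mod_cast hk) hIo.uniqueDiffOn).congr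
    (iteratedDerivWithin_of_isOpen hIo).symm

theorem hasDerivAt_iteratedDeriv {I : Set ℝ} (hIo : IsOpen I) {N k : ℕ} {f : ℝ → ℝ}
    (hf : ContDiffOn ℝ N f I) (hk : k < N) {y : ℝ} (hy : y ∈ I) :
    HasDerivAt (iteratedDeriv k f) (iteratedDeriv (k + 1) f y) y := by
  have h : DifferentiableOn ℝ (iteratedDeriv k f) I :=
    (hf.differentiableOn_iteratedDerivWithin (by exact_mod_cast hk) hIo.uniqueDiffOn).congr
      (iteratedDerivWithin_of_isOpen hIo).symm
  rw [iteratedDeriv_succ]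
  exact (h.differentiableAt (hIo.mem_nhds hy)).hasDerivAt

/-- The factor `u ^ k`, whose integral is `1 / (k + 1)`, is what produces the factorials in the
comparison of divided differences with Taylor coefficients. -/
theorem iteratedDeriv_dslope {I : Set ℝ} (hIo : IsOpen I) (hI : I.OrdConnected) {N : ℕ}
    {f : ℝ → ℝ} (hf : ContDiffOn ℝ (N + 1 : ℕ) f I) {x : ℝ} (hx : x ∈ I) {k : ℕ} (hk : k ≤ N) :
    ∀ y ∈ I, iteratedDeriv k (dslope f x) y =
      ∫ u in (0 : ℝ)..1, u ^ k * iteratedDeriv (k + 1) f (x + u * (y - x)) := by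
  induction k with
  | zero =>
    intro y hy
    simpa using dslope_eq_integral hIo hI (hf.of_le (by simp)) hx hy
  | succ k ih =>
    intro y hy
    have heq : iteratedDeriv k (dslope f x) =ᶠ[𝓝 y] fun y =>
        ∫ u in (0 : ℝ)..1, u ^ k * iteratedDeriv (k + 1) f (x + u * (y - x)) := by
      filter_upwards [hIo.mem_nhds hy] with z hz using ih (by omega) z hz
    rw [iteratedDeriv_succ, heq.deriv_eq]
    exact (hasDerivAt_integral_segment hIo hI
      (fun z hz => hasDerivAt_iteratedDeriv hIo hf (by omega) hz)
      (continuousOn_iteratedDeriv hIo hf (by omega)) k hx hy).deriv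

/-- Taking a difference quotient costs one derivative, as Hadamard's lemma says. -/
theorem contDiffOn_dslope {I : Set ℝ} (hIo : IsOpen I) (hI : I.OrdConnected) {N : ℕ}
    {f : ℝ → ℝ} (hf : ContDiffOn ℝ (N + 1 : ℕ) f I) {x : ℝ} (hx : x ∈ I) :
    ContDiffOn ℝ N (dslope f x) I := by
  have heq : ∀ k ≤ N, ∀ y ∈ I, iteratedDeriv k (dslope f x) =ᶠ[𝓝 y] fun y =>
      ∫ u in (0 : ℝ)..1, u ^ k * iteratedDeriv (k + 1) f (x + u * (y - x)) := by
    intro k hk y hy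
    filter_upwards [hIo.mem_nhds hy] with z hz using iteratedDeriv_dslope hIo hI hf hx hk z hz
  rw [contDiffOn_nat_iff_continuousOn_differentiableOn_deriv hIo.uniqueDiffOn]
  refine ⟨fun k hk => ContinuousOn.congr (fun y hy => ?_) (iteratedDerivWithin_of_isOpen hIo),
    fun k hk => DifferentiableOn.congr (fun y hy => ?_) (iteratedDerivWithin_of_isOpen hIo)⟩
  · exact ((continuousAt_congr (heq k hk y hy)).mpr (continuousAt_integral_segment hIo hI
      (continuousOn_iteratedDeriv hIo hf (by omega)) k hx hy)).continuousWithinAt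
  · exact (((heq k hk.le y hy).differentiableAt_iff).mpr (hasDerivAt_integral_segment hIo hI
      (fun z hz => hasDerivAt_iteratedDeriv hIo hf (by omega) hz)
      (continuousOn_iteratedDeriv hIo hf (by omega)) k hx
        hy).differentiableAt).differentiableWithinAt

/-! ### Divided differences -/

theorem divDiff_cons (f : ℝ → ℝ) (x : ℝ) {l : List ℝ} (hl : l ≠ []) :
    divDiff f (x :: l) = divDiff (dslope f x) l := by
  cases l with
  | nil => exact absurd rfl hl
  | cons y l => rfl

/-- As a function of its last point, a divided difference is an iterated difference quotient. -/
theorem divDiff_append_singleton (f : ℝ → ℝ) (l : List ℝ) (x : ℝ) :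
    divDiff f (l ++ [x]) = l.foldl dslope f x := by
  induction l generalizing f with
  | nil => rfl
  | cons y l ih => rw [List.cons_append, divDiff_cons _ _ (by simp), ih, List.foldl_cons]

theorem dslope_comm (f : ℝ → ℝ) (x y : ℝ) : dslope f x y = dslope f y x := by
  rcases eq_or_ne y x with rfl | h
  · rfl
  · rw [dslope_of_ne f h, dslope_of_ne f h.symm, slope_comm]

theorem dslope_dslope_of_ne {f : ℝ → ℝ} {x y : ℝ} (hf : DifferentiableAt ℝ f x) (h : x ≠ y) :
    dslope (dslope f x) y x = dslope (dslope f y) x x := by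
  have hd : deriv (dslope f y) x = (deriv f x * (x - y) - (f x - f y)) / (x - y) ^ 2 := by
    have he : dslope f y =ᶠ[𝓝 x] fun z => (f z - f y) / (z - y) := by
      filter_upwards [dslope_eventuallyEq_slope_of_ne f h] with z hz
      rw [hz, slope_def_field]
    rw [he.deriv_eq]
    have := (hf.hasDerivAt.sub_const (f y)).div ((hasDerivAt_id x).sub_const y)
      (sub_ne_zero.mpr h)
    exact this.deriv.trans (by simp)
  have hxy : x - y ≠ 0 := sub_ne_zero.mpr h
  have hyx : y - x ≠ 0 := sub_ne_zero.mpr h.symm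
  rw [dslope_same, hd, dslope_of_ne _ h, slope_def_field, dslope_same, dslope_of_ne f h.symm,
    slope_def_field]
  field_simp
  ring

/-- Difference quotients commute; differentiability is needed only where points coincide. -/
theorem dslope_dslope_comm {f : ℝ → ℝ} {x y : ℝ} (hx : DifferentiableAt ℝ f x)
    (hy : DifferentiableAt ℝ f y) : dslope (dslope f x) y = dslope (dslope f y) x := by
  rcases eq_or_ne x y with rfl | hxy
  · rfl
  funext z
  rcases eq_or_ne z x with rfl | hzx
  · exact dslope_dslope_of_ne hx hxy
  rcases eq_or_ne z y with rfl | hzy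
  · exact (dslope_dslope_of_ne hy hxy.symm).symm
  have h1 : z - x ≠ 0 := sub_ne_zero.mpr hzx
  have h2 : z - y ≠ 0 := sub_ne_zero.mpr hzy
  have h3 : x - y ≠ 0 := sub_ne_zero.mpr hxy
  have h4 : y - x ≠ 0 := sub_ne_zero.mpr hxy.symm
  rw [dslope_of_ne _ hzy, dslope_of_ne _ hzx, slope_def_field, slope_def_field,
    dslope_of_ne _ hzx, dslope_of_ne _ hzy, dslope_of_ne _ hxy, dslope_of_ne _ hxy.symm]
  simp only [slope_def_field]
  field_simp
  ring

/-- Divided differences do not depend on the order of the points. -/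
theorem divDiff_perm {I : Set ℝ} (hIo : IsOpen I) (hI : I.OrdConnected) {l l' : List ℝ}
    (h : l.Perm l') : ∀ {N : ℕ} {f : ℝ → ℝ}, ContDiffOn ℝ N f I → l.length ≤ N + 1 →
      (∀ x ∈ l, x ∈ I) → divDiff f l = divDiff f l' := by
  induction h with
  | nil => intros; rfl
  | @cons x l l' h ih =>
    intro N f hf hlen hl
    rcases eq_or_ne l [] with rfl | hne
    · rw [h.nil_eq]
    have hne' : l' ≠ [] := fun h' => hne (by simpa [h'] using h)
    have hpos : 0 < l.length := List.length_pos_iff.mpr hne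
    rw [List.length_cons] at hlen
    obtain ⟨N, rfl⟩ : ∃ M, N = M + 1 := ⟨N - 1, by omega⟩
    rw [divDiff_cons _ _ hne, divDiff_cons _ _ hne']
    exact ih (contDiffOn_dslope hIo hI hf (hl x (by simp))) (by omega)
      fun z hz => hl z (by simp [hz])
  | swap x y l =>
    intro N f hf hlen hl
    rcases eq_or_ne l [] with rfl | hne
    · exact dslope_comm f y x
    rw [List.length_cons, List.length_cons] at hlen
    have hpos : 0 < l.length := List.length_pos_iff.mpr hne
    have hd : ∀ z ∈ y :: x :: l, DifferentiableAt ℝ f z := fun z hz =>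
      (hf.differentiableOn (by simp; omega)).differentiableAt (hIo.mem_nhds (hl z hz))
    rw [divDiff_cons _ _ (by simp), divDiff_cons _ _ hne, divDiff_cons _ _ (by simp),
      divDiff_cons _ _ hne, dslope_dslope_comm (hd y (by simp)) (hd x (by simp))]
  | trans h₁ _ ih₁ ih₂ =>
    intro N f hf hlen hl
    rw [ih₁ hf hlen hl]
    exact ih₂ hf (h₁.length_eq ▸ hlen) fun x hx => hl x (h₁.mem_iff.mpr hx)

/-- If `f⁽ᵏ⁾` is within `ε` of the constant `c` on an interval `S`, then divided differences of
order `k` with points in `S` are within `ε / k!` of `c / k!`. -/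
theorem abs_divDiff_sub_le {I S : Set ℝ} (hIo : IsOpen I) (hI : I.OrdConnected)
    (hS : S.OrdConnected) (hSI : S ⊆ I) (c ε : ℝ) (l : List ℝ) :
    ∀ {k : ℕ} {f : ℝ → ℝ}, ContDiffOn ℝ k f I → (∀ y ∈ S, |iteratedDeriv k f y - c| ≤ ε) →
      l.length = k + 1 → (∀ x ∈ l, x ∈ S) →
      |divDiff f l - c / (k.factorial : ℝ)| ≤ ε / (k.factorial : ℝ) := by
  induction l generalizing c ε with
  | nil => intro k f _ _ hl; simp at hl
  | cons x l ih =>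
    intro k f hf hb hlen hl
    rw [List.length_cons] at hlen
    have hx : x ∈ S := hl x (by simp)
    rcases k with _ | k
    · obtain rfl : l = [] := List.length_eq_zero_iff.mp (by omega)
      simpa [divDiff] using hb x hx
    have hne : l ≠ [] := List.length_pos_iff.mp (by omega)
    rw [divDiff_cons _ _ hne]
    have := ih (c / (k + 1 : ℕ)) (ε / (k + 1 : ℕ)) (k := k)
      (contDiffOn_dslope hIo hI hf (hSI hx)) ?_ (by omega) fun z hz => hl z (by simp [hz])
    · rw [Nat.factorial_succ]
      push_cast at this ⊢
      rwa [div_div, div_div] at this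
    intro y hy
    have hpow : ∫ u in (0 : ℝ)..1, u ^ k = 1 / (k + 1 : ℕ) := by
      simp [integral_pow]
    have hcont := continuousOn_comp_segment hI (continuousOn_iteratedDeriv hIo hf le_rfl) k
      (hSI hx) (hSI hy)
    have hint : iteratedDeriv k (dslope f x) y - c / (k + 1 : ℕ) =
        ∫ u in (0 : ℝ)..1, u ^ k * (iteratedDeriv (k + 1) f (x + u * (y - x)) - c) := by
      rw [iteratedDeriv_dslope hIo hI hf (hSI hx) le_rfl y (hSI hy)]
      simp only [mul_sub _ _ c]
      rw [integral_sub hcont.intervalIntegrable (by apply Continuous.intervalIntegrable; fun_prop),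
        integral_mul_const, hpow]
      ring
    have hcε : (ε / (k + 1 : ℕ) : ℝ) = ∫ u in (0 : ℝ)..1, u ^ k * ε := by
      rw [integral_mul_const, hpow]; ring
    rw [hint, hcε, ← Real.norm_eq_abs]
    refine norm_integral_le_of_norm_le zero_le_one (.of_forall fun u hu => ?_)
      (by apply Continuous.intervalIntegrable; fun_prop)
    have hu' := Ioc_subset_Icc_self hu
    rw [norm_mul, Real.norm_of_nonneg (pow_nonneg hu'.1 _)]
    exact mul_le_mul_of_nonneg_left (hb _ (add_mul_sub_mem hS hx hy hu')) (pow_nonneg hu'.1 _)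

/-- Divided differences of order at most `N` of a `C^N` function, with points close to `t`, are
close to the Taylor coefficients at `t`. -/
theorem exists_divDiff_near {I : Set ℝ} (hIo : IsOpen I) (hI : I.OrdConnected) {N : ℕ}
    {f : ℝ → ℝ} (hf : ContDiffOn ℝ N f I) {t : ℝ} (ht : t ∈ I) {ε : ℝ} (hε : 0 < ε) :
    ∃ δ > 0, Icc (t - δ) (t + δ) ⊆ I ∧ ∀ k ≤ N, ∀ l : List ℝ, l.length = k + 1 →
      (∀ x ∈ l, x ∈ Icc (t - δ) (t + δ)) →
      |divDiff f l - iteratedDeriv k f t / (k.factorial : ℝ)| ≤ ε := by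
  have hev : ∀ᶠ y in 𝓝 t, y ∈ I ∧ ∀ k ∈ Finset.range (N + 1),
      |iteratedDeriv k f y - iteratedDeriv k f t| ≤ ε := by
    refine (hIo.eventually_mem ht).and ((Finset.eventually_all _).mpr fun k hk => ?_)
    have hc := (continuousOn_iteratedDeriv hIo hf
      (Nat.lt_succ_iff.mp (Finset.mem_range.mp hk))).continuousAt (hIo.mem_nhds ht)
    filter_upwards [hc.eventually (Metric.closedBall_mem_nhds _ hε)] with y hy
    simpa [Real.dist_eq] using hy
  obtain ⟨δ, hδ, hball⟩ := Metric.nhds_basis_closedBall.mem_iff.mp hev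
  rw [Real.closedBall_eq_Icc] at hball
  refine ⟨δ, hδ, fun y hy => (hball hy).1, fun k hk l hl hmem => ?_⟩
  refine (abs_divDiff_sub_le hIo hI ordConnected_Icc (fun y hy => (hball hy).1)
    (iteratedDeriv k f t) ε l (hf.of_le (by exact_mod_cast hk))
    (fun y hy => (hball hy).2 k (Finset.mem_range.mpr (by omega))) hl hmem).trans ?_
  exact div_le_self hε.le (by exact_mod_cast Nat.succ_le_of_lt k.factorial_pos)

/-- Newton's interpolation formula with nodes `τ 0, …, τ (m - 1)` and its remainder. -/
theorem eq_newton_add_remainder (f : ℝ → ℝ) (τ : ℕ → ℝ) (m : ℕ) (y : ℝ) :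
    f y = ∑ a ∈ Finset.range m, (∏ b ∈ Finset.range a, (y - τ b)) *
        divDiff f ((List.range (a + 1)).map τ) +
      (∏ b ∈ Finset.range m, (y - τ b)) * ((List.range m).map τ).foldl dslope f y := by
  induction m with
  | zero => simp
  | succ m ih =>
    rw [Finset.sum_range_succ, Finset.prod_range_succ]
    conv_lhs => rw [ih]
    simp only [List.range_succ, List.map_append, List.map_cons, List.map_nil, List.foldl_append,
      List.foldl_cons, List.foldl_nil]
    rw [divDiff_append_singleton]
    have := sub_smul_dslope (((List.range m).map τ).foldl dslope f) (τ m) y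
    rw [smul_eq_mul] at this
    rw [mul_assoc _ (y - τ m), this]
    ring

/-- At a node the remainder of Newton's formula vanishes. Coincident nodes are allowed, and `f` may
be arbitrary. -/
theorem eq_newton_of_lt (f : ℝ → ℝ) (τ : ℕ → ℝ) {m i : ℕ} (hi : i < m) :
    f (τ i) = ∑ a ∈ Finset.range m, (∏ b ∈ Finset.range a, (τ i - τ b)) *
        divDiff f ((List.range (a + 1)).map τ) := by
  have h0 : ∏ b ∈ Finset.range m, (τ i - τ b) = 0 :=
    Finset.prod_eq_zero (Finset.mem_range.mpr hi) (sub_self _)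
  conv_lhs => rw [eq_newton_add_remainder f τ m (τ i), h0, zero_mul, add_zero]

/-! ### The Kraus matrix and Newton interpolation -/

/-- The matrix `([t_i, s, t_j]_f)`, `i, j = 1, …, r`, whose determinant is `krausDet f t r s`. -/
noncomputable def krausMatrix (f : ℝ → ℝ) (t : ℕ → ℝ) (r : ℕ) (s : ℝ) :
    Matrix (Fin r) (Fin r) ℝ :=
  Matrix.of fun i j => divDiff f [t (i + 1), s, t (j + 1)]

/-- The values at `t_1, …, t_r` of the Newton polynomials `∏_{b ≤ a} (x - t_b)`,
`a = 0, …, r - 1`. It is lower triangular. -/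
noncomputable def newtonMatrix (t : ℕ → ℝ) (r : ℕ) : Matrix (Fin r) (Fin r) ℝ :=
  Matrix.of fun i a => ∏ b ∈ Finset.range a, (t (i + 1) - t (b + 1))

theorem mem_initialPoints {t : ℕ → ℝ} {i : ℕ} {x : ℝ} :
    x ∈ initialPoints t i ↔ ∃ k < i, t (k + 1) = x := by
  simp [initialPoints]

@[simp]
theorem length_initialPoints (t : ℕ → ℝ) (i : ℕ) : (initialPoints t i).length = i := by
  simp [initialPoints]

theorem initialPoints_succ_ne_nil (t : ℕ → ℝ) (i : ℕ) : initialPoints t (i + 1) ≠ [] :=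
  List.length_pos_iff.mp (by simp)

theorem divDiff_append (f : ℝ → ℝ) (l : List ℝ) {l' : List ℝ} (hl' : l' ≠ []) :
    divDiff f (l ++ l') = divDiff (l.foldl dslope f) l' := by
  induction l generalizing f with
  | nil => rfl
  | cons x l ih =>
    rw [List.cons_append, divDiff_cons _ _ (by simp [hl']), ih, List.foldl_cons]

/-- Newton interpolation in the last point of a divided difference. -/
theorem divDiff_append_eq_sum (f : ℝ → ℝ) (l : List ℝ) (t : ℕ → ℝ) {r : ℕ} (i : Fin r) :
    divDiff f (l ++ [t (i + 1)]) =
      ∑ a : Fin r, newtonMatrix t r i a * divDiff f (l ++ initialPoints t (a + 1)) := by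
  have h := eq_newton_of_lt (l.foldl dslope f) (fun b => t (b + 1)) i.isLt
  rw [divDiff_append_singleton, h,
    ← Fin.sum_univ_eq_sum_range (fun a => (∏ b ∈ Finset.range a, (t (i + 1) - t (b + 1))) *
      divDiff (l.foldl dslope f) ((List.range (a + 1)).map fun b => t (b + 1))) r]
  refine Finset.sum_congr rfl fun a _ => ?_
  rw [divDiff_append _ _ (initialPoints_succ_ne_nil t a)]
  rfl

/-- Newton interpolation in both outer points of `[t_i, s, t_j]_f` factors the Kraus matrix. -/
theorem krausMatrix_eq {I : Set ℝ} (hIo : IsOpen I) (hI : I.OrdConnected) {f : ℝ → ℝ} {r : ℕ}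
    (hf : ContDiffOn ℝ (2 * r : ℕ) f I) {t : ℕ → ℝ} (ht : ∀ i < r, t (i + 1) ∈ I) {s : ℝ}
    (hs : s ∈ I) :
    krausMatrix f t r s = newtonMatrix t r * krausM f t r s * (newtonMatrix t r).transpose := by
  have hperm : ∀ {l l' : List ℝ}, l.Perm l' → l.length ≤ 2 * r + 1 → (∀ x ∈ l, x ∈ I) →
      divDiff f l = divDiff f l' := fun h hlen hl => divDiff_perm hIo hI h hf hlen hl
  have hinit : ∀ (a : Fin r) (x : ℝ), x ∈ initialPoints t (a + 1) → x ∈ I := by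
    intro a x hx
    obtain ⟨k, hk, rfl⟩ := mem_initialPoints.mp hx
    exact ht k (by omega)
  ext i j
  have hr : 1 ≤ r := i.pos
  have h1 : krausMatrix f t r s i j = divDiff f ([s, t (j + 1)] ++ [t (i + 1)]) := by
    refine hperm (List.perm_append_comm (l₁ := [t (i + 1)])) (by simp; omega) ?_
    simp [hs, ht i i.isLt, ht j j.isLt]
  have h2 : ∀ a : Fin r, divDiff f ([s, t (j + 1)] ++ initialPoints t (a + 1)) =
      ∑ b : Fin r, newtonMatrix t r j b * krausM f t r s a b := by
    intro a
    have h3 : divDiff f ([s, t (j + 1)] ++ initialPoints t (a + 1)) =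
        divDiff f ((s :: initialPoints t (a + 1)) ++ [t (j + 1)]) := by
      refine hperm (.cons _ (List.perm_append_comm (l₁ := [t (j + 1)]))) (by simp; omega) ?_
      simp only [List.mem_append, List.mem_cons, List.not_mem_nil, or_false]
      rintro x ((rfl | rfl) | hx)
      exacts [hs, ht j j.isLt, hinit a x hx]
    rw [h3, divDiff_append_eq_sum]
    refine Finset.sum_congr rfl fun b _ => congrArg _ ?_
    refine hperm (List.perm_middle.symm) (by simp; omega) ?_
    simp only [List.mem_append, List.mem_cons]
    rintro x ((rfl | hx) | hx)
    exacts [hs, hinit a x hx, hinit b x hx]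
  rw [h1, divDiff_append_eq_sum]
  simp only [Matrix.mul_apply, Matrix.transpose_apply, Finset.sum_mul]
  rw [Finset.sum_comm]
  refine Finset.sum_congr rfl fun a _ => ?_
  rw [h2, Finset.mul_sum]
  exact Finset.sum_congr rfl fun b _ => by ring

/-- The matrix is triangular, since its `a`-th Newton polynomial vanishes at the first `a` nodes. -/
theorem det_newtonMatrix (t : ℕ → ℝ) (r : ℕ) :
    (newtonMatrix t r).det =
      ∏ i ∈ Finset.range r, ∏ b ∈ Finset.range i, (t (i + 1) - t (b + 1)) := by
  rw [Matrix.det_of_isLowerTriangular]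
  · exact Fin.prod_univ_eq_prod_range
      (fun i => ∏ b ∈ Finset.range i, (t (i + 1) - t (b + 1))) r
  · intro i a hia
    have hlt : (i : ℕ) < a := hia
    exact Finset.prod_eq_zero (Finset.mem_range.mpr hlt) (sub_self _)

/-- A product over pairs `l < k + l ≤ r`, ordered by the difference `k` on the left-hand side and by
the larger index on the right-hand side. -/
theorem prod_Icc_prod_Icc_add {M : Type*} [CommMonoid M] (F : ℕ → ℕ → M) (r : ℕ) :
    ∏ k ∈ Finset.Icc 1 (r - 1), ∏ l ∈ Finset.Icc 1 (r - k), F (k + l) l =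
      ∏ i ∈ Finset.range r, ∏ b ∈ Finset.range i, F (i + 1) (b + 1) := by
  rw [Finset.prod_sigma', Finset.prod_sigma']
  refine Finset.prod_bij' (fun p _ => ⟨p.1 + p.2 - 1, p.2 - 1⟩) (fun p _ => ⟨p.1 - p.2, p.2 + 1⟩)
    ?_ ?_ ?_ ?_ ?_
  all_goals
    rintro ⟨a, b⟩ h
    simp only [Finset.mem_sigma, Finset.mem_Icc, Finset.mem_range] at h ⊢
  · omega
  · omega
  · rw [Sigma.mk.injEq, heq_eq_eq]; omega
  · rw [Sigma.mk.injEq, heq_eq_eq]; omega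
  · rw [show a + b - 1 + 1 = a + b by omega, show b - 1 + 1 = b by omega]

theorem krausDet_eq {I : Set ℝ} (hIo : IsOpen I) (hI : I.OrdConnected) {f : ℝ → ℝ} {r : ℕ}
    (hf : ContDiffOn ℝ (2 * r : ℕ) f I) {t : ℕ → ℝ} (ht : ∀ i < r, t (i + 1) ∈ I) {s : ℝ}
    (hs : s ∈ I) :
    krausDet f t r s = (krausM f t r s).det *
      ∏ k ∈ Finset.Icc 1 (r - 1), ∏ l ∈ Finset.Icc 1 (r - k), (t (k + l) - t l) ^ 2 := by
  change (krausMatrix f t r s).det = _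
  rw [krausMatrix_eq hIo hI hf ht hs, Matrix.det_mul, Matrix.det_mul, Matrix.det_transpose,
    prod_Icc_prod_Icc_add (fun i j => (t i - t j) ^ 2)]
  simp only [Finset.prod_pow]
  rw [← det_newtonMatrix]
  ring

theorem isHermitian_krausM {I : Set ℝ} (hIo : IsOpen I) (hI : I.OrdConnected) {f : ℝ → ℝ} {r : ℕ}
    (hf : ContDiffOn ℝ (2 * r : ℕ) f I) {t : ℕ → ℝ} (ht : ∀ i < r, t (i + 1) ∈ I) {s : ℝ}
    (hs : s ∈ I) : (krausM f t r s).IsHermitian := by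
  ext i j
  rw [Matrix.conjTranspose_apply, star_trivial]
  refine divDiff_perm hIo hI ?_ hf (by simp; omega) ?_
  · refine List.perm_append_comm.trans ?_
    rw [List.cons_append]
    exact List.perm_middle.symm
  · simp only [List.mem_append, List.mem_cons, mem_initialPoints]
    rintro x (⟨k, hk, rfl⟩ | rfl | ⟨k, hk, rfl⟩)
    exacts [ht k (by omega), hs, ht k (by omega)]

theorem posSemidef_krausMatrix {I : Set ℝ} (hIo : IsOpen I) (hI : I.OrdConnected) {f : ℝ → ℝ}
    {r : ℕ} (hf : ContDiffOn ℝ (2 * r : ℕ) f I) {t : ℕ → ℝ} (ht : ∀ i < r, t (i + 1) ∈ I) {s : ℝ}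
    (hs : s ∈ I) (h : (krausM f t r s).PosSemidef) : (krausMatrix f t r s).PosSemidef := by
  rw [krausMatrix_eq hIo hI hf ht hs, ← Matrix.conjTranspose_eq_transpose_of_trivial]
  exact h.mul_mul_conjTranspose_same _

/-- For distinct nodes the Newton matrix is invertible, so that the factorization of the Kraus matrix
can be inverted. -/
theorem posSemidef_krausM {I : Set ℝ} (hIo : IsOpen I) (hI : I.OrdConnected) {f : ℝ → ℝ}
    {r : ℕ} (hf : ContDiffOn ℝ (2 * r : ℕ) f I) {t : ℕ → ℝ} (ht : ∀ i < r, t (i + 1) ∈ I)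
    (hinj : Set.InjOn (fun i => t (i + 1)) (Set.Iio r)) {s : ℝ} (hs : s ∈ I)
    (h : (krausMatrix f t r s).PosSemidef) : (krausM f t r s).PosSemidef := by
  have hdet : IsUnit (newtonMatrix t r) := by
    rw [Matrix.isUnit_iff_isUnit_det, det_newtonMatrix, isUnit_iff_ne_zero]
    refine Finset.prod_ne_zero_iff.mpr fun i hi => Finset.prod_ne_zero_iff.mpr fun b hb => ?_
    rw [Finset.mem_range] at hi hb
    exact sub_ne_zero.mpr fun he => hb.ne' (hinj hi (hb.trans hi) he)
  rw [krausMatrix_eq hIo hI hf ht hs, ← Matrix.conjTranspose_eq_transpose_of_trivial] at h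
  exact (Matrix.IsUnit.posSemidef_star_right_conjugate_iff hdet).mp h

/-- If `t_1, …, t_r` and `s` are close to `t₀`, then `M_r` is entrywise close to `K_r(f; t₀)`. -/
theorem exists_krausM_near {I : Set ℝ} (hIo : IsOpen I) (hI : I.OrdConnected) {f : ℝ → ℝ}
    {r : ℕ} (hf : ContDiffOn ℝ (2 * r : ℕ) f I) {t₀ : ℝ} (ht₀ : t₀ ∈ I) {ε : ℝ} (hε : 0 < ε) :
    ∃ δ > 0, Icc (t₀ - δ) (t₀ + δ) ⊆ I ∧ ∀ t : ℕ → ℝ,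
      (∀ i < r, t (i + 1) ∈ Icc (t₀ - δ) (t₀ + δ)) → ∀ s ∈ Icc (t₀ - δ) (t₀ + δ), ∀ i j,
        |krausM f t r s i j - hankelK r f t₀ i j| ≤ ε := by
  obtain ⟨δ, hδ, hsub, h⟩ := exists_divDiff_near hIo hI hf ht₀ hε
  refine ⟨δ, hδ, hsub, fun t ht s hs i j => ?_⟩
  refine h ((i + 1) + (j + 1)) (by omega) _ (by simp; omega) ?_
  simp only [List.mem_append, List.mem_cons, mem_initialPoints]
  rintro x (⟨k, hk, rfl⟩ | rfl | ⟨k, hk, rfl⟩)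
  exacts [ht k (by omega), hs, ht k (by omega)]

/-! ### Second-order perturbation of matrix functions -/

open scoped Matrix.Norms.L2Operator

/-- The spectrum of a matrix is finite, so any function is continuous on it. -/
theorem continuousOn_real_spectrum {n : ℕ} (f : ℝ → ℝ) (A : Matrix (Fin n) (Fin n) ℂ) :
    ContinuousOn f (spectrum ℝ A) :=
  A.finite_real_spectrum.continuousOn f

/-- The noncommutative form of `f x = f c + [c, x]_f (x - c)`. -/
theorem cfc_eq_add_dslope {n : ℕ} (f : ℝ → ℝ) {A : Matrix (Fin n) (Fin n) ℂ} (hA : A.IsHermitian)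
    (c : ℝ) :
    cfc f A = algebraMap ℝ _ (f c) + cfc (dslope f c) A * (A - algebraMap ℝ _ c) := by
  have hA' : IsSelfAdjoint A := hA
  have hcont := fun g : ℝ → ℝ => continuousOn_real_spectrum g A
  have h1 : A - algebraMap ℝ _ c = cfc (fun x => x - c) A := by
    rw [cfc_sub _ _ A (hcont _) (hcont _), cfc_id' ℝ A, cfc_const c A]
  rw [h1, ← cfc_mul _ _ A (hcont _) (hcont _), ← cfc_const_add _ _ A (hcont _)]
  congr 1
  funext x
  have := sub_smul_dslope f c x
  rw [smul_eq_mul] at this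
  linear_combination -this

/-- Columnwise comparison of `f(A)` with `f(C)` for a diagonal matrix `C`. -/
theorem cfc_apply_eq_add_dslope {n : ℕ} (f : ℝ → ℝ) {A : Matrix (Fin n) (Fin n) ℂ}
    (hA : A.IsHermitian) (c : Fin n → ℝ) (i j : Fin n) :
    cfc f A i j = Matrix.diagonal (fun i => (f (c i) : ℂ)) i j +
      (cfc (dslope f (c j)) A * (A - Matrix.diagonal fun i => (c i : ℂ))) i j := by
  rw [cfc_eq_add_dslope f hA (c j), Matrix.add_apply, Matrix.mul_apply, Matrix.mul_apply]
  congr 1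
  · rw [Matrix.algebraMap_matrix_apply, Matrix.diagonal_apply]
    split_ifs with h
    · subst h; rfl
    · rfl
  · refine Finset.sum_congr rfl fun k _ => ?_
    rw [Matrix.sub_apply, Matrix.sub_apply, Matrix.algebraMap_matrix_apply, Matrix.diagonal_apply]
    split_ifs with h
    · subst h; rfl
    · rfl

theorem isHermitian_diagonal_ofReal {n : ℕ} (c : Fin n → ℝ) :
    (Matrix.diagonal fun i => (c i : ℂ)).IsHermitian :=
  Matrix.isHermitian_diagonal_of_self_adjoint _ (funext fun i => Complex.conj_ofReal (c i))

theorem cfc_diagonal_ofReal {n : ℕ} (f : ℝ → ℝ) (c : Fin n → ℝ) :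
    cfc f (Matrix.diagonal fun i => (c i : ℂ)) = Matrix.diagonal fun i => (f (c i) : ℂ) := by
  ext i j
  rw [cfc_apply_eq_add_dslope f (isHermitian_diagonal_ofReal c) c i j, sub_self, mul_zero,
    Matrix.zero_apply, add_zero]

theorem spectrum_diagonal_ofReal_subset {n : ℕ} (c : Fin n → ℝ) :
    spectrum ℝ (Matrix.diagonal fun i => (c i : ℂ)) ⊆ Set.range c := by
  intro x hx
  by_contra h
  refine hx ?_
  rw [spectrum.mem_resolventSet_iff]
  have he : algebraMap ℝ (Matrix (Fin n) (Fin n) ℂ) x - Matrix.diagonal (fun i => (c i : ℂ)) =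
      Matrix.diagonal fun i => ((x : ℂ) - c i) := by
    rw [Matrix.algebraMap_eq_diagonal, Matrix.diagonal_sub]
    rfl
  rw [he, Matrix.isUnit_diagonal, Pi.isUnit_iff]
  intro i
  rw [isUnit_iff_ne_zero, sub_ne_zero]
  intro hxi
  exact h ⟨i, (Complex.ofReal_injective hxi).symm⟩

theorem isHermitian_add_smul {n : ℕ} {C X : Matrix (Fin n) (Fin n) ℂ} (hC : C.IsHermitian)
    (hX : X.IsHermitian) (h : ℝ) : (C + h • X).IsHermitian :=
  hC.add (IsSelfAdjoint.smul (.all h) hX)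

theorem tendsto_cfc_add_smul {n : ℕ} {S : Set ℝ} (hS : IsCompact S) {g : ℝ → ℝ}
    (hg : ContinuousOn g S) {C X : Matrix (Fin n) (Fin n) ℂ} (hC : C.IsHermitian)
    (hX : X.IsHermitian) (hspec : ∀ᶠ h : ℝ in 𝓝 0, spectrum ℝ (C + h • X) ⊆ S) :
    Tendsto (fun h : ℝ => cfc g (C + h • X)) (𝓝 0) (𝓝 (cfc g C)) := by
  have h0 : spectrum ℝ C ⊆ S := by simpa using hspec.self_of_nhds
  have hlim : Tendsto (fun h : ℝ => C + h • X) (𝓝 0) (𝓝 C) := by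
    have : Continuous fun h : ℝ => C + h • X := by fun_prop
    simpa using this.tendsto 0
  exact hlim.cfc hS g hspec (.of_forall fun h => isHermitian_add_smul hC hX h) h0 hC hg

/-- The Daleckii–Krein formula at a diagonal matrix: the derivative of `g(C + h X)` has entries
`[c_i, c_k]_g X_ik`. Only continuity of the functional calculus is needed, for the difference
quotient is exactly a column of `[c_k, ·]_g (C + h X) X`. -/
theorem tendsto_cfc_slope {n : ℕ} {I S : Set ℝ} (hIo : IsOpen I) (hS : IsCompact S) (hSI : S ⊆ I)
    {g : ℝ → ℝ} (hg : DifferentiableOn ℝ g I) {c : Fin n → ℝ} (hc : ∀ i, c i ∈ I)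
    {X : Matrix (Fin n) (Fin n) ℂ} (hX : X.IsHermitian)
    (hspec : ∀ᶠ h : ℝ in 𝓝 0, spectrum ℝ ((Matrix.diagonal fun i => (c i : ℂ)) + h • X) ⊆ S)
    (i k : Fin n) :
    Tendsto (fun h : ℝ => (h : ℂ)⁻¹ * (cfc g ((Matrix.diagonal fun i => (c i : ℂ)) + h • X) i k -
        cfc g (Matrix.diagonal fun i => (c i : ℂ)) i k))
      (𝓝[≠] 0) (𝓝 (((dslope g (c k) (c i) : ℝ) : ℂ) * X i k)) := by
  have hC := isHermitian_diagonal_ofReal c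
  have hd : ContinuousOn (dslope g (c k)) S := by
    refine ContinuousOn.mono ?_ hSI
    rw [continuousOn_dslope (hIo.mem_nhds (hc k))]
    exact ⟨hg.continuousOn, hg.differentiableAt (hIo.mem_nhds (hc k))⟩
  have hlim := tendsto_cfc_add_smul hS hd hC hX hspec
  have hlim' : Tendsto (fun h : ℝ =>
      (cfc (dslope g (c k)) ((Matrix.diagonal fun i => (c i : ℂ)) + h • X) * X) i k) (𝓝[≠] 0)
      (𝓝 (((dslope g (c k) (c i) : ℝ) : ℂ) * X i k)) := by
    have h1 : Continuous fun Y : Matrix (Fin n) (Fin n) ℂ => (Y * X) i k := by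
      simp only [Matrix.mul_apply]
      fun_prop
    have h2 := ((h1.tendsto _).comp hlim).mono_left (nhdsWithin_le_nhds (s := {0}ᶜ))
    rw [cfc_diagonal_ofReal, Matrix.diagonal_mul] at h2
    exact h2
  refine hlim'.congr' ?_
  filter_upwards [self_mem_nhdsWithin] with h hh
  have hh' : (h : ℂ) ≠ 0 := by exact_mod_cast hh
  rw [cfc_apply_eq_add_dslope g (isHermitian_add_smul hC hX h) c i k, cfc_diagonal_ofReal,
    add_sub_cancel_left, add_sub_cancel_left, Matrix.mul_smul, Matrix.smul_apply,
    Complex.real_smul, inv_mul_cancel_left₀ hh']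

/-- The second derivative of `f(C + h X)` at a diagonal matrix, as a symmetric second difference. In
column `j` that difference is `h (g(C + h X) - g(C - h X)) X` with `g = [c_j, ·]_f`, which reduces it
to the first derivative of `g`. -/
theorem tendsto_cfc_second_difference {n : ℕ} {I S : Set ℝ} (hIo : IsOpen I)
    (hI : I.OrdConnected) (hS : IsCompact S) (hSI : S ⊆ I)
    {f : ℝ → ℝ} (hf : ContDiffOn ℝ 2 f I) {c : Fin n → ℝ} (hc : ∀ i, c i ∈ I)
    {X : Matrix (Fin n) (Fin n) ℂ} (hX : X.IsHermitian)
    (hspec : ∀ᶠ h : ℝ in 𝓝 0, spectrum ℝ ((Matrix.diagonal fun i => (c i : ℂ)) + h • X) ⊆ S)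
    (i j : Fin n) :
    Tendsto (fun h : ℝ => (h : ℂ)⁻¹ ^ 2 *
        (cfc f ((Matrix.diagonal fun i => (c i : ℂ)) + h • X) +
          cfc f ((Matrix.diagonal fun i => (c i : ℂ)) + (-h) • X) -
          (2 : ℂ) • cfc f (Matrix.diagonal fun i => (c i : ℂ))) i j)
      (𝓝[≠] 0) (𝓝 (2 * ∑ k, (divDiff f [c j, c k, c i] : ℂ) * (X i k * X k j))) := by
  have hC := isHermitian_diagonal_ofReal c
  have hg : DifferentiableOn ℝ (dslope f (c j)) I :=
    (contDiffOn_dslope (N := 1) hIo hI (by exact_mod_cast hf) (hc j)).differentiableOn (by simp)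
  have h1 := fun k => tendsto_cfc_slope hIo hS hSI hg hc hX hspec i k
  have hneg : Tendsto (fun h : ℝ => -h) (𝓝[≠] 0) (𝓝[≠] 0) := by
    refine tendsto_nhdsWithin_of_tendsto_nhds_of_eventually_within _ ?_ ?_
    · simpa using (continuous_neg.tendsto (0 : ℝ)).mono_left (nhdsWithin_le_nhds (s := {0}ᶜ))
    · filter_upwards [self_mem_nhdsWithin] with h hh using neg_ne_zero.mpr hh
  have h2 := tendsto_finsetSum Finset.univ fun k (_ : k ∈ Finset.univ) =>
    ((h1 k).add ((h1 k).comp hneg)).mul_const (X k j)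
  have hlim : ∑ k, (((dslope (dslope f (c j)) (c k) (c i) : ℝ) : ℂ) * X i k +
      ((dslope (dslope f (c j)) (c k) (c i) : ℝ) : ℂ) * X i k) * X k j =
      2 * ∑ k, (divDiff f [c j, c k, c i] : ℂ) * (X i k * X k j) := by
    rw [Finset.mul_sum]
    refine Finset.sum_congr rfl fun k _ => ?_
    rw [show divDiff f [c j, c k, c i] = dslope (dslope f (c j)) (c k) (c i) from rfl]
    ring
  rw [hlim] at h2
  refine h2.congr' ?_
  filter_upwards [self_mem_nhdsWithin] with h hh
  have hh' : (h : ℂ) ≠ 0 := by exact_mod_cast hh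
  simp only [Matrix.add_apply, Matrix.sub_apply, Matrix.smul_apply, Function.comp_apply]
  rw [cfc_apply_eq_add_dslope f (isHermitian_add_smul hC hX h) c i j,
    cfc_apply_eq_add_dslope f (isHermitian_add_smul hC hX (-h)) c i j, cfc_diagonal_ofReal f,
    add_sub_cancel_left, add_sub_cancel_left, Matrix.mul_smul, Matrix.mul_smul, Matrix.smul_apply,
    Matrix.smul_apply, Complex.real_smul, Complex.real_smul, Matrix.mul_apply, Matrix.mul_apply]
  have : ∀ P Q D : ℂ, (h : ℂ)⁻¹ ^ 2 * (D + (h : ℂ) * P + (D + ((-h : ℝ) : ℂ) * Q) - (2 : ℂ) • D) =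
      (h : ℂ)⁻¹ * (P - Q) := by
    intro P Q D
    push_cast
    rw [smul_eq_mul]
    field_simp
    ring
  rw [this, ← Finset.sum_sub_distrib, Finset.mul_sum]
  refine Finset.sum_congr rfl fun k _ => ?_
  push_cast
  field_simp
  ring

/-- The second derivative of `h ↦ ⟨w, f(C + h X) w⟩` at `h = 0`, for diagonal `C`, as a sum of
values of the quadratic forms of the Kraus matrices at `s = c k`. -/
theorem tendsto_quadForm_second_difference {n : ℕ} {I S : Set ℝ} (hIo : IsOpen I)
    (hI : I.OrdConnected) (hS : IsCompact S) (hSI : S ⊆ I)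
    {f : ℝ → ℝ} (hf : ContDiffOn ℝ 2 f I) {c : Fin n → ℝ} (hc : ∀ i, c i ∈ I)
    {X : Matrix (Fin n) (Fin n) ℂ} (hX : X.IsHermitian)
    (hspec : ∀ᶠ h : ℝ in 𝓝 0, spectrum ℝ ((Matrix.diagonal fun i => (c i : ℂ)) + h • X) ⊆ S)
    (w : Fin n → ℂ) :
    Tendsto (fun h : ℝ => h⁻¹ ^ 2 * (star w ⬝ᵥ
        (cfc f ((Matrix.diagonal fun i => (c i : ℂ)) + h • X) +
          cfc f ((Matrix.diagonal fun i => (c i : ℂ)) + (-h) • X) -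
          (2 : ℂ) • cfc f (Matrix.diagonal fun i => (c i : ℂ))).mulVec w).re)
      (𝓝[≠] 0) (𝓝 (2 * ∑ k, ∑ i, ∑ j, divDiff f [c j, c k, c i] *
        ((X k i * w i).re * (X k j * w j).re + (X k i * w i).im * (X k j * w j).im))) := by
  have h1 := tendsto_finsetSum Finset.univ fun i (_ : i ∈ Finset.univ) =>
    tendsto_finsetSum Finset.univ fun j (_ : j ∈ Finset.univ) =>
    ((tendsto_cfc_second_difference hIo hI hS hSI hf hc hX hspec i j).const_mul
      (star (w i))).mul_const (w j)
  have h2 := (Complex.continuous_re.tendsto _).comp h1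
  have hlim : (∑ i, ∑ j, star (w i) *
      (2 * ∑ k, (divDiff f [c j, c k, c i] : ℂ) * (X i k * X k j)) * w j).re =
      2 * ∑ k, ∑ i, ∑ j, divDiff f [c j, c k, c i] *
        ((X k i * w i).re * (X k j * w j).re + (X k i * w i).im * (X k j * w j).im) := by
    have h3 : ∑ i, ∑ j, star (w i) *
        (2 * ∑ k, (divDiff f [c j, c k, c i] : ℂ) * (X i k * X k j)) * w j =
        ((2 : ℝ) : ℂ) * ∑ k, ∑ i, ∑ j, (divDiff f [c j, c k, c i] : ℂ) *
          (star (X k i * w i) * (X k j * w j)) := by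
      rw [Finset.sum_comm (s := Finset.univ) (f := fun k i => ∑ j, _), Finset.mul_sum]
      refine Finset.sum_congr rfl fun i _ => ?_
      rw [Finset.sum_comm, Finset.mul_sum]
      refine Finset.sum_congr rfl fun j _ => ?_
      simp only [Finset.mul_sum, Finset.sum_mul]
      refine Finset.sum_congr rfl fun k _ => ?_
      rw [star_mul', hX.apply i k]
      push_cast
      ring
    rw [h3, Complex.re_ofReal_mul]
    simp only [Complex.re_sum, Complex.re_ofReal_mul]
    refine congrArg _ (Finset.sum_congr rfl fun k _ => Finset.sum_congr rfl fun i _ =>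
      Finset.sum_congr rfl fun j _ => congrArg _ ?_)
    generalize X k i * w i = a
    generalize X k j * w j = b
    simp [Complex.mul_re]
  rw [hlim] at h2
  refine h2.congr fun h => ?_
  rw [Function.comp_apply, ← Complex.re_ofReal_mul]
  congr 1
  simp only [dotProduct, Matrix.mulVec, Finset.mul_sum, Pi.star_apply]
  refine Finset.sum_congr rfl fun i _ => Finset.sum_congr rfl fun j _ => ?_
  push_cast
  ring

theorem eventually_spectrum_add_smul_subset {n : ℕ} {S : Set ℝ} {C : Matrix (Fin n) (Fin n) ℂ}
    (hC : spectrum ℝ C ⊆ interior S) (X : Matrix (Fin n) (Fin n) ℂ) :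
    ∀ᶠ h : ℝ in 𝓝 0, spectrum ℝ (C + h • X) ⊆ S := by
  have hlim : Tendsto (fun h : ℝ => C + h • X) (𝓝 0) (𝓝 C) := by
    have : Continuous fun h : ℝ => C + h • X := by fun_prop
    simpa using this.tendsto 0
  have h1 := upperHemicontinuous_spectrum ℝ (Matrix (Fin n) (Fin n) ℂ) C S
    (mem_nhdsSet_iff_forall.mpr fun x hx => mem_interior_iff_mem_nhds.mp (hC hx))
  filter_upwards [hlim.eventually h1] with h hh using subset_of_mem_nhdsSet hh

/-! ### Necessity of the Hankel condition -/

/-- Convexity at the midpoint `diag(c)` of `diag(c) ± h X` makes the second derivative in direction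
`X` nonnegative. -/
theorem IsMatrixConvexOn.sum_divDiff_nonneg {n : ℕ} {I : Set ℝ} (hIo : IsOpen I)
    (hI : I.OrdConnected) {f : ℝ → ℝ} (hf : ContDiffOn ℝ 2 f I) (hconv : IsMatrixConvexOn n I f)
    {c : Fin n → ℝ} (hc : ∀ i, c i ∈ I) {X : Matrix (Fin n) (Fin n) ℂ} (hX : X.IsHermitian)
    (w : Fin n → ℂ) :
    0 ≤ ∑ k, ∑ i, ∑ j, divDiff f [c j, c k, c i] *
      ((X k i * w i).re * (X k j * w j).re + (X k i * w i).im * (X k j * w j).im) := by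
  obtain ⟨S, hS, hcS, hSI⟩ := exists_compact_between (Set.finite_range c).isCompact hIo
    (Set.range_subset_iff.mpr hc)
  have hspec := eventually_spectrum_add_smul_subset
    ((spectrum_diagonal_ofReal_subset c).trans hcS) X
  have hlim := tendsto_quadForm_second_difference hIo hI hS hSI hf hc hX hspec w
  have hneg : Tendsto (fun h : ℝ => -h) (𝓝 0) (𝓝 0) := by
    simpa using continuous_neg.tendsto (0 : ℝ)
  -- The limit is twice the sum in question.
  have h0 := ge_of_tendsto hlim (b := 0) ?_
  · linarith
  filter_upwards [nhdsWithin_le_nhds hspec, nhdsWithin_le_nhds (hneg.eventually hspec)]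
    with h h1 h2
  refine mul_nonneg (by positivity) ?_
  have hC := isHermitian_diagonal_ofReal c
  have hpsd := hconv _ _ (isHermitian_add_smul hC hX h) (isHermitian_add_smul hC hX (-h))
    (h1.trans hSI) (h2.trans hSI) (1 / 2) ⟨by norm_num, by norm_num⟩
  have hmid : (1 / 2 : ℝ) • ((Matrix.diagonal fun i => (c i : ℂ)) + h • X) +
      (1 - 1 / 2 : ℝ) • ((Matrix.diagonal fun i => (c i : ℂ)) + (-h) • X) =
      Matrix.diagonal fun i => (c i : ℂ) := by
    module
  rw [hmid] at hpsd
  have hpsd2 := hpsd.smul (a := (2 : ℝ)) zero_le_two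
  have heq : cfc f ((Matrix.diagonal fun i => (c i : ℂ)) + h • X) +
      cfc f ((Matrix.diagonal fun i => (c i : ℂ)) + (-h) • X) -
      (2 : ℂ) • cfc f (Matrix.diagonal fun i => (c i : ℂ)) =
      (2 : ℝ) • ((1 / 2 : ℝ) • cfc f ((Matrix.diagonal fun i => (c i : ℂ)) + h • X) +
        (1 - 1 / 2 : ℝ) • cfc f ((Matrix.diagonal fun i => (c i : ℂ)) + (-h) • X) -
        cfc f (Matrix.diagonal fun i => (c i : ℂ))) := by
    have : ∀ M : Matrix (Fin n) (Fin n) ℂ, (2 : ℂ) • M = (2 : ℝ) • M := fun M => by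
      rw [two_smul, two_smul]
    rw [this]
    module
  rw [heq]
  exact (Complex.nonneg_iff.mp (hpsd2.dotProduct_mulVec_nonneg w)).1

/-- The Kraus matrix of an `n`-convex function at a point `s = t_k` is positive semidefinite. In the
second derivative at `diag(t)` the direction `X` and the vector `w` are chosen with all mass of
`X` in row and column `k`, and scaled so that only the term of index `k` survives as `ε → 0`. -/
theorem IsMatrixConvexOn.posSemidef_krausMatrix {n : ℕ} {I : Set ℝ} (hIo : IsOpen I)
    (hI : I.OrdConnected) {f : ℝ → ℝ} (hn : 1 ≤ n) (hf : ContDiffOn ℝ (2 * n : ℕ) f I)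
    (hconv : IsMatrixConvexOn n I f) {t : ℕ → ℝ} (ht : ∀ i < n, t (i + 1) ∈ I) (k₀ : Fin n) :
    (krausMatrix f t n (t (k₀ + 1))).PosSemidef := by
  have hf2 : ContDiffOn ℝ 2 f I := hf.of_le (by exact_mod_cast (by omega : 2 ≤ 2 * n))
  refine .of_dotProduct_mulVec_nonneg ?_ fun y => ?_
  · ext i j
    rw [Matrix.conjTranspose_apply, star_trivial]
    exact divDiff_perm hIo hI (List.reverse_perm [t (i + 1), t (k₀ + 1), t (j + 1)])
      hf (by simp; omega) (by simp [ht])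
  set c : Fin n → ℝ := fun i => t (i + 1) with hcdef
  set R : ℝ := ∑ k ∈ Finset.univ.erase k₀, divDiff f [c k₀, c k, c k₀] * y k ^ 2 with hR
  have key : ∀ ε : ℝ, ε ≠ 0 →
      0 ≤ ∑ i, ∑ j, divDiff f [c j, c k₀, c i] * (y i * y j) + ε ^ 2 * R := by
    intro ε hε
    set ξ : Fin n → ℝ := fun i => if i = k₀ then y i else ε * y i with hξ
    set X : Matrix (Fin n) (Fin n) ℂ := Matrix.of fun i j =>
      if i = k₀ then (ξ j : ℂ) else if j = k₀ then (ξ i : ℂ) else 0 with hXdef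
    set w : Fin n → ℂ := fun i => if i = k₀ then 1 else ((ε⁻¹ : ℝ) : ℂ) with hw
    have hX : X.IsHermitian := by
      ext i j
      rw [Matrix.conjTranspose_apply]
      simp only [hXdef, Matrix.of_apply]
      split_ifs with h1 h2 <;> simp [*]
    have hXw₀ : ∀ i, X k₀ i * w i = (y i : ℂ) := by
      intro i
      simp only [hXdef, hw, hξ, Matrix.of_apply, if_true]
      split_ifs with h
      · simp
      · push_cast
        have : (ε : ℂ) ≠ 0 := by exact_mod_cast hε
        field_simp
    have hXw : ∀ k ≠ k₀, ∀ i, X k i * w i = if i = k₀ then ((ε * y k : ℝ) : ℂ) else 0 := by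
      intro k hk i
      simp only [hXdef, hw, hξ, Matrix.of_apply, if_neg hk]
      split_ifs with h <;> simp
    have h0 := hconv.sum_divDiff_nonneg hIo hI hf2 (c := c) (fun i => ht i i.isLt) hX w
    rw [← Finset.add_sum_erase _ _ (Finset.mem_univ k₀)] at h0
    convert h0 using 2
    · refine Finset.sum_congr rfl fun i _ => Finset.sum_congr rfl fun j _ => ?_
      rw [hXw₀, hXw₀]
      simp
    · rw [hR, Finset.mul_sum]
      refine Finset.sum_congr rfl fun k hk => ?_
      have hk' := Finset.ne_of_mem_erase hk
      rw [Finset.sum_eq_single k₀, Finset.sum_eq_single k₀]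
      · rw [hXw k hk', if_pos rfl]
        simp
        ring
      · intro j _ hj
        rw [hXw k hk' j, if_neg hj]
        simp
      · simp
      · intro i _ hi
        rw [hXw k hk' i, if_neg hi]
        simp
      · simp
  have hlim : Tendsto (fun ε : ℝ => ∑ i, ∑ j, divDiff f [c j, c k₀, c i] * (y i * y j) + ε ^ 2 * R)
      (𝓝[≠] 0) (𝓝 (∑ i, ∑ j, divDiff f [c j, c k₀, c i] * (y i * y j))) := by
    have : Continuous fun ε : ℝ =>
        ∑ i, ∑ j, divDiff f [c j, c k₀, c i] * (y i * y j) + ε ^ 2 * R := by fun_prop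
    simpa using (this.tendsto 0).mono_left (nhdsWithin_le_nhds (s := {0}ᶜ))
  have h1 := ge_of_tendsto hlim (b := 0)
    (by filter_upwards [self_mem_nhdsWithin] with ε hε using key ε hε)
  rw [Finset.sum_comm] at h1
  refine h1.trans_eq ?_
  simp only [dotProduct, Matrix.mulVec, Finset.mul_sum]
  refine Finset.sum_congr rfl fun i _ => Finset.sum_congr rfl fun j _ => ?_
  simp only [krausMatrix, Matrix.of_apply, hcdef, Pi.star_apply, star_trivial]
  ring

theorem isHermitian_hankelK (n : ℕ) (f : ℝ → ℝ) (t : ℝ) : (hankelK n f t).IsHermitian := by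
  ext i j
  rw [Matrix.conjTranspose_apply, star_trivial]
  simp only [hankelK, Matrix.of_apply]
  rw [add_comm ((j : ℕ) + 1)]

theorem abs_quadForm_sub_le {n : ℕ} {M K : Matrix (Fin n) (Fin n) ℝ} {ε : ℝ}
    (h : ∀ i j, |M i j - K i j| ≤ ε) (y : Fin n → ℝ) :
    |y ⬝ᵥ M.mulVec y - y ⬝ᵥ K.mulVec y| ≤ ε * (∑ i, |y i|) ^ 2 := by
  rw [← dotProduct_sub, ← Matrix.sub_mulVec]
  simp only [dotProduct, Matrix.mulVec, Finset.mul_sum, Matrix.sub_apply]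
  rw [sq, Finset.sum_mul_sum, Finset.mul_sum]
  refine (Finset.abs_sum_le_sum_abs _ _).trans (Finset.sum_le_sum fun i _ => ?_)
  rw [Finset.mul_sum]
  refine (Finset.abs_sum_le_sum_abs _ _).trans (Finset.sum_le_sum fun j _ => ?_)
  rw [abs_mul, abs_mul]
  calc |y i| * (|M i j - K i j| * |y j|) = |M i j - K i j| * (|y i| * |y j|) := by ring
    _ ≤ ε * (|y i| * |y j|) := by gcongr; exact h i j

/-- The Hankel matrix is the limit of the matrices `M_n` at distinct nodes that merge in `t₀`; these
are congruent to Kraus matrices. -/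
theorem IsMatrixConvexOn.posSemidef_hankelK {n : ℕ} {I : Set ℝ} (hIo : IsOpen I)
    (hI : I.OrdConnected) {f : ℝ → ℝ} (hf : ContDiffOn ℝ (2 * n : ℕ) f I)
    (hconv : IsMatrixConvexOn n I f) {t₀ : ℝ} (ht₀ : t₀ ∈ I) : (hankelK n f t₀).PosSemidef := by
  rcases Nat.eq_zero_or_pos n with rfl | hn
  · rw [Subsingleton.elim (hankelK 0 f t₀) 0]
    exact .zero
  refine .of_dotProduct_mulVec_nonneg (isHermitian_hankelK n f t₀) fun y => ?_
  have hclose : ∀ ε > 0, ∃ M : Matrix (Fin n) (Fin n) ℝ, M.PosSemidef ∧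
      ∀ i j, |M i j - hankelK n f t₀ i j| ≤ ε := by
    intro ε hε
    obtain ⟨δ, hδ, hsub, h⟩ := exists_krausM_near hIo hI hf ht₀ hε
    -- Equally spaced, hence distinct, nodes within `δ` of `t₀`.
    set t : ℕ → ℝ := fun i => t₀ + δ * (i / n) with ht
    have hn' : (0 : ℝ) < n := by exact_mod_cast hn
    have hmem : ∀ i < n, t (i + 1) ∈ Icc (t₀ - δ) (t₀ + δ) := by
      intro i hi
      have h1 : ((i + 1 : ℕ) : ℝ) / n ≤ 1 := by
        rw [div_le_one hn']
        exact_mod_cast hi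
      have h2 : 0 ≤ ((i + 1 : ℕ) : ℝ) / n := by positivity
      constructor
      · simp only [ht]; nlinarith
      · simp only [ht]; nlinarith
    have hinj : Set.InjOn (fun i => t (i + 1)) (Set.Iio n) := by
      intro i _ j _ hij
      simp only [ht, add_right_inj, mul_eq_mul_left_iff, hδ.ne', or_false] at hij
      rw [div_left_inj' hn'.ne'] at hij
      exact Nat.succ_injective (by exact_mod_cast hij)
    refine ⟨krausM f t n (t 1), ?_, h t hmem _ (hmem 0 hn)⟩
    exact posSemidef_krausM hIo hI hf (fun i hi => hsub (hmem i hi)) hinj (hsub (hmem 0 hn))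
      (hconv.posSemidef_krausMatrix hIo hI hn hf (fun i hi => hsub (hmem i hi)) ⟨0, hn⟩)
  rw [star_trivial]
  by_contra! hneg
  set q := y ⬝ᵥ (hankelK n f t₀).mulVec y
  set m := (∑ i, |y i|) ^ 2
  have hm : 0 ≤ m := sq_nonneg _
  obtain ⟨M, hM, hMK⟩ := hclose (-q / (m + 1)) (div_pos (by linarith) (by linarith))
  have h1 := (abs_le.mp (abs_quadForm_sub_le hMK y)).2
  have h2 := hM.dotProduct_mulVec_nonneg y
  rw [star_trivial] at h2
  have h3 : -q / (m + 1) * m < -q := by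
    rw [div_mul_eq_mul_div, div_lt_iff₀ (by linarith)]
    nlinarith
  linarith

/-! ### Sufficiency of the Hankel condition -/

/-- Positive definiteness is stable under entrywise small perturbations. -/
theorem Matrix.PosDef.exists_posSemidef_near {n : ℕ} {K : Matrix (Fin n) (Fin n) ℝ}
    (hK : K.PosDef) : ∃ ε > 0, ∀ M : Matrix (Fin n) (Fin n) ℝ, M.IsHermitian →
      (∀ i j, |M i j - K i j| ≤ ε) → M.PosSemidef := by
  have hcont : Continuous fun y : Fin n → ℝ => y ⬝ᵥ K.mulVec y := by
    simp only [dotProduct, Matrix.mulVec]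
    fun_prop
  obtain ⟨δ, hδ, hmin⟩ := (isCompact_sphere (0 : Fin n → ℝ) 1).exists_forall_le'
    hcont.continuousOn (a := 0) fun y hy => by
      have := hK.dotProduct_mulVec_pos (x := y) (by rintro rfl; simp at hy)
      rwa [star_trivial] at this
  refine ⟨δ / (n ^ 2 + 1), by positivity, fun M hM hMK => .of_dotProduct_mulVec_nonneg hM ?_⟩
  -- On the unit sphere of the sup norm `∑ |y i| ≤ n`, so the perturbation changes the form by at
  -- most `n² ε ≤ δ`.
  have hsphere : ∀ y ∈ Metric.sphere (0 : Fin n → ℝ) 1, 0 ≤ y ⬝ᵥ M.mulVec y := by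
    intro y hy
    have h1 := (abs_le.mp (abs_quadForm_sub_le hMK y)).1
    have h2 := hmin y hy
    have h3 : ∑ i, |y i| ≤ n := by
      calc ∑ i, |y i| ≤ ∑ _i : Fin n, (1 : ℝ) := Finset.sum_le_sum fun i _ => by
            rw [← mem_sphere_zero_iff_norm.mp hy]
            exact norm_le_pi_norm y i
        _ = n := by simp
    have h4 : (∑ i, |y i|) ^ 2 ≤ (n : ℝ) ^ 2 :=
      pow_le_pow_left₀ (Finset.sum_nonneg fun i _ => abs_nonneg _) h3 2
    have h5 : δ / (n ^ 2 + 1) * (∑ i, |y i|) ^ 2 ≤ δ := by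
      rw [div_mul_eq_mul_div, div_le_iff₀ (by positivity)]
      nlinarith
    linarith
  intro y
  rw [star_trivial]
  rcases eq_or_ne y 0 with rfl | hy
  · simp
  have hy' : ‖y‖ ≠ 0 := norm_ne_zero_iff.mpr hy
  have h1 := hsphere (‖y‖⁻¹ • y) (by simp [norm_smul, hy'])
  rw [Matrix.mulVec_smul, dotProduct_smul, smul_dotProduct, smul_smul, smul_eq_mul] at h1
  exact nonneg_of_mul_nonneg_right h1 (by positivity)

theorem Matrix.IsHermitian.posSemidef_of_re_nonneg {n : ℕ} {M : Matrix (Fin n) (Fin n) ℂ}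
    (hM : M.IsHermitian) (h : ∀ v : Fin n → ℂ, 0 ≤ (star v ⬝ᵥ M.mulVec v).re) : M.PosSemidef :=
  .of_dotProduct_mulVec_nonneg hM fun v =>
    Complex.nonneg_iff.mpr ⟨h v, (hM.im_star_dotProduct_mulVec_self v).symm⟩

/-- A continuous function whose symmetric second derivative is nonnegative lies below its chord:
after subtracting a small multiple of `x (1 - x)`, an interior maximum above the chord would have
a negative second derivative. -/
theorem le_chord_of_symmetric_second_derivative_nonneg {φ : ℝ → ℝ}
    (hφ : ContinuousOn φ (Icc 0 1))
    (hd : ∀ τ ∈ Ioo (0 : ℝ) 1, ∃ L, 0 ≤ L ∧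
      Tendsto (fun h => h⁻¹ ^ 2 * (φ (τ + h) + φ (τ - h) - 2 * φ τ)) (𝓝[≠] 0) (𝓝 L))
    {c : ℝ} (hc : c ∈ Icc (0 : ℝ) 1) : φ c ≤ c * φ 1 + (1 - c) * φ 0 := by
  by_contra! hlt
  set ε := φ c - (c * φ 1 + (1 - c) * φ 0) with hε
  have hεpos : 0 < ε := by linarith
  set ψ : ℝ → ℝ := fun x => φ x - (x * φ 1 + (1 - x) * φ 0) - ε * (x * (1 - x)) with hψ
  have hψc : ContinuousOn ψ (Icc 0 1) := by fun_prop
  obtain ⟨τ, hτ, hmax⟩ := isCompact_Icc.exists_isMaxOn ⟨c, hc⟩ hψc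
  have hcpos : 0 < ψ c := by
    have : ψ c = ε - ε * (c * (1 - c)) := by simp only [hψ, hε]
    rw [this]
    nlinarith [sq_nonneg (c - 1 / 2)]
  have hτpos : 0 < ψ τ := hcpos.trans_le (hmax hc)
  have hτ' : τ ∈ Ioo (0 : ℝ) 1 := by
    refine ⟨lt_of_le_of_ne hτ.1 ?_, lt_of_le_of_ne hτ.2 ?_⟩
    · rintro rfl
      simp [hψ] at hτpos
    · rintro rfl
      simp [hψ] at hτpos
  obtain ⟨L, hL, hlim⟩ := hd τ hτ'
  have hle : L ≤ -(2 * ε) := by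
    refine le_of_tendsto hlim ?_
    have h1 : ∀ᶠ h : ℝ in 𝓝 0, τ + h ∈ Icc (0 : ℝ) 1 := by
      have : Tendsto (fun h : ℝ => τ + h) (𝓝 0) (𝓝 τ) := by
        simpa using (continuous_const_add τ).tendsto 0
      exact this.eventually (Icc_mem_nhds hτ'.1 hτ'.2)
    have h2 : ∀ᶠ h : ℝ in 𝓝 0, τ - h ∈ Icc (0 : ℝ) 1 := by
      have : Tendsto (fun h : ℝ => τ - h) (𝓝 0) (𝓝 τ) := by
        simpa using (continuous_sub_left τ).tendsto 0
      exact this.eventually (Icc_mem_nhds hτ'.1 hτ'.2)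
    filter_upwards [nhdsWithin_le_nhds h1, nhdsWithin_le_nhds h2, self_mem_nhdsWithin]
      with h hh1 hh2 hh
    have hh0 : h ≠ 0 := hh
    have m1 := hmax hh1
    have m2 := hmax hh2
    simp only [hψ, mem_ofPred_eq] at m1 m2
    rw [inv_pow, inv_mul_le_iff₀ (by positivity)]
    nlinarith
  linarith

theorem spectrum_convex_combination_subset {n : ℕ} {a b : ℝ} {A B : Matrix (Fin n) (Fin n) ℂ}
    (hA : A.IsHermitian) (hB : B.IsHermitian) (hAs : spectrum ℝ A ⊆ Icc a b)
    (hBs : spectrum ℝ B ⊆ Icc a b) {τ : ℝ} (hτ : τ ∈ Icc (0 : ℝ) 1) :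
    spectrum ℝ (τ • A + (1 - τ) • B) ⊆ Icc a b := by
  open scoped MatrixOrder in
  have hA' : IsSelfAdjoint A := hA
  have hB' : IsSelfAdjoint B := hB
  have hC : IsSelfAdjoint (τ • A + (1 - τ) • B) :=
    (IsSelfAdjoint.smul (.all τ) hA').add (IsSelfAdjoint.smul (.all _) hB')
  have hτ' : 0 ≤ 1 - τ := sub_nonneg.mpr hτ.2
  have hconst : ∀ r : ℝ, algebraMap ℝ (Matrix (Fin n) (Fin n) ℂ) r =
      τ • algebraMap ℝ _ r + (1 - τ) • algebraMap ℝ _ r := fun r => by module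
  have hlow : algebraMap ℝ _ a ≤ τ • A + (1 - τ) • B := by
    rw [hconst a]
    exact add_le_add
      (smul_le_smul_of_nonneg_left (algebraMap_le_of_le_spectrum fun x hx => (hAs hx).1) hτ.1)
      (smul_le_smul_of_nonneg_left (algebraMap_le_of_le_spectrum fun x hx => (hBs hx).1) hτ')
  have hupp : τ • A + (1 - τ) • B ≤ algebraMap ℝ _ b := by
    rw [hconst b]
    exact add_le_add
      (smul_le_smul_of_nonneg_left (le_algebraMap_of_spectrum_le fun x hx => (hAs hx).2) hτ.1)
      (smul_le_smul_of_nonneg_left (le_algebraMap_of_spectrum_le fun x hx => (hBs hx).2) hτ')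
  exact fun x hx => ⟨(algebraMap_le_iff_le_spectrum hC).mp hlow x hx,
    (le_algebraMap_iff_spectrum_le hC).mp hupp x hx⟩

/-- The Hermitian form of a real positive semidefinite matrix at a complex vector, split into real
and imaginary parts. -/
theorem sum_mul_re_im_nonneg {n : ℕ} {K : Matrix (Fin n) (Fin n) ℝ} (hK : K.PosSemidef)
    (z : Fin n → ℂ) :
    0 ≤ ∑ i, ∑ j, K j i * ((z i).re * (z j).re + (z i).im * (z j).im) := by
  have h1 := hK.dotProduct_mulVec_nonneg fun i => (z i).re
  have h2 := hK.dotProduct_mulVec_nonneg fun i => (z i).im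
  refine (add_nonneg h1 h2).trans_eq ?_
  rw [Finset.sum_comm]
  simp only [dotProduct, Matrix.mulVec, Finset.mul_sum, ← Finset.sum_add_distrib, Pi.star_apply,
    star_trivial]
  exact Finset.sum_congr rfl fun i _ => Finset.sum_congr rfl fun j _ => by ring

/-- If all Kraus matrices with points in a compact interval are positive semidefinite, then the
function `τ ↦ ⟨v, f(H + τ X) v⟩` has a nonnegative symmetric second derivative. -/
theorem exists_symmetric_second_derivative_nonneg {n : ℕ} {I S : Set ℝ} (hIo : IsOpen I)
    (hI : I.OrdConnected) (hS : IsCompact S) (hSI : S ⊆ I) {f : ℝ → ℝ}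
    (hf : ContDiffOn ℝ 2 f I)
    (hK : ∀ t : ℕ → ℝ, (∀ i < n, t (i + 1) ∈ S) → ∀ s ∈ S, (krausMatrix f t n s).PosSemidef)
    {H X : Matrix (Fin n) (Fin n) ℂ} (hH : H.IsHermitian) (hX : X.IsHermitian)
    (hspec : ∀ᶠ h : ℝ in 𝓝 0, spectrum ℝ (H + h • X) ⊆ S) (v : Fin n → ℂ) :
    ∃ L, 0 ≤ L ∧ Tendsto (fun h : ℝ => h⁻¹ ^ 2 * ((star v ⬝ᵥ (cfc f (H + h • X)).mulVec v).re +
      (star v ⬝ᵥ (cfc f (H + (-h) • X)).mulVec v).re - 2 * (star v ⬝ᵥ (cfc f H).mulVec v).re))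
      (𝓝[≠] 0) (𝓝 L) := by
  set U := hH.eigenvectorUnitary
  set c := hH.eigenvalues
  set α := Unitary.conjStarAlgAut ℝ (Matrix (Fin n) (Fin n) ℂ) U with hα
  set D : Matrix (Fin n) (Fin n) ℂ := Matrix.diagonal fun i => (c i : ℂ) with hD
  have hHD : H = α D := hH.spectral_theorem
  set Y := α.symm X with hYdef
  have hYX : α Y = X := α.apply_symm_apply X
  have hY : Y.IsHermitian := by
    change star Y = Y
    rw [hYdef, ← map_star]
    exact congrArg _ hX
  have hadd : ∀ h : ℝ, H + h • X = α (D + h • Y) := by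
    intro h
    rw [map_add, map_smul, hYX, ← hHD]
  have hαc : Continuous α := by
    have : (α : Matrix (Fin n) (Fin n) ℂ → Matrix (Fin n) (Fin n) ℂ) =
        fun M => (U : Matrix (Fin n) (Fin n) ℂ) * M * star (U : Matrix (Fin n) (Fin n) ℂ) := rfl
    rw [this]
    fun_prop
  have hcfc : ∀ h : ℝ, cfc f (H + h • X) = α (cfc f (D + h • Y)) := by
    intro h
    have h1 : IsSelfAdjoint (D + h • Y) := isHermitian_add_smul (isHermitian_diagonal_ofReal c) hY h
    have h2 : IsSelfAdjoint (α (D + h • Y)) := hadd h ▸ isHermitian_add_smul hH hX h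
    rw [hadd]
    exact (StarAlgHomClass.map_cfc (S := ℝ) α f _ (continuousOn_real_spectrum f _) hαc h1 h2).symm
  have hcfc0 : cfc f H = α (cfc f D) := by simpa using hcfc 0
  have hspec' : ∀ᶠ h : ℝ in 𝓝 0, spectrum ℝ (D + h • Y) ⊆ S := by
    filter_upwards [hspec] with h hh
    rwa [hadd, AlgEquiv.spectrum_eq] at hh
  have hcS : ∀ i, c i ∈ S := fun i => by
    have h0 : spectrum ℝ H ⊆ S := by simpa using hspec.self_of_nhds
    exact h0 (hH.eigenvalues_mem_spectrum_real i)
  set w : Fin n → ℂ := (star (U : Matrix (Fin n) (Fin n) ℂ)).mulVec v with hw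
  have hquad : ∀ M : Matrix (Fin n) (Fin n) ℂ,
      star v ⬝ᵥ (α M).mulVec v = star w ⬝ᵥ M.mulVec w := by
    intro M
    rw [hα, Unitary.conjStarAlgAut_apply, hw, Matrix.star_mulVec, ← Matrix.mulVec_mulVec,
      ← Matrix.mulVec_mulVec, Matrix.dotProduct_mulVec, Matrix.star_eq_conjTranspose,
      Matrix.conjTranspose_conjTranspose]
  have hlim := tendsto_quadForm_second_difference hIo hI hS hSI hf (fun i => hSI (hcS i)) hY
    hspec' w
  refine ⟨_, ?_, hlim.congr fun h => ?_⟩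
  · refine mul_nonneg zero_le_two (Finset.sum_nonneg fun k _ => ?_)
    -- The eigenvalues as a sequence `t_1, …, t_n`; the value `0` elsewhere is never read.
    set t : ℕ → ℝ := fun m => if h : m - 1 < n then c ⟨m - 1, h⟩ else 0 with ht
    have htc : ∀ i : Fin n, t (i + 1) = c i := fun i => by simp [ht]
    have hPSD := hK t (fun i hi => by rw [htc ⟨i, hi⟩]; exact hcS _) (c k) (hcS k)
    have := sum_mul_re_im_nonneg hPSD fun i => Y k i * w i
    simpa only [krausMatrix, Matrix.of_apply, htc] using this
  · rw [hcfc, hcfc, hcfc0, hquad, hquad, hquad, Matrix.sub_mulVec, Matrix.add_mulVec,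
      Matrix.smul_mulVec, dotProduct_sub, dotProduct_add, dotProduct_smul, Complex.sub_re,
      Complex.add_re, smul_eq_mul, show (2 : ℂ) = ((2 : ℝ) : ℂ) by norm_num, Complex.re_ofReal_mul]

/-- Kraus' criterion, sufficiency: convexity is tested along the segment between two matrices, whose
spectra stay in the interval. -/
theorem isMatrixConvexOn_of_posSemidef_krausMatrix {n : ℕ} {I : Set ℝ} (hIo : IsOpen I)
    (hI : I.OrdConnected) {a b : ℝ} (hSI : Icc a b ⊆ I) {f : ℝ → ℝ} (hf : ContDiffOn ℝ 2 f I)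
    (hK : ∀ t : ℕ → ℝ, (∀ i < n, t (i + 1) ∈ Icc a b) → ∀ s ∈ Icc a b,
      (krausMatrix f t n s).PosSemidef) : IsMatrixConvexOn n (Icc a b) f := by
  intro A B hA hB hAs hBs τ₀ hτ₀
  have hherm : ∀ M : Matrix (Fin n) (Fin n) ℂ, IsSelfAdjoint (cfc f M) := fun M =>
    cfc_predicate f M
  have hpath : ∀ τ : ℝ, (τ • A + (1 - τ) • B).IsHermitian := fun τ =>
    (IsSelfAdjoint.smul (.all τ) hA).add (IsSelfAdjoint.smul (.all _) hB)
  have hspec := fun τ (hτ : τ ∈ Icc (0 : ℝ) 1) =>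
    spectrum_convex_combination_subset hA hB hAs hBs hτ
  refine Matrix.IsHermitian.posSemidef_of_re_nonneg
    (((IsSelfAdjoint.smul (.all _) (hherm A)).add (IsSelfAdjoint.smul (.all _) (hherm B))).sub
      (hherm _)) fun v => ?_
  set φ : ℝ → ℝ := fun τ => (star v ⬝ᵥ (cfc f (τ • A + (1 - τ) • B)).mulVec v).re with hφ
  have hφc : ContinuousOn φ (Icc 0 1) := by
    have h1 : ContinuousOn (fun τ : ℝ => cfc f (τ • A + (1 - τ) • B)) (Icc 0 1) :=
      ContinuousOn.cfc' isCompact_Icc f (by fun_prop) hspec (fun τ _ => hpath τ)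
        (hf.continuousOn.mono hSI)
    have h2 : Continuous fun M : Matrix (Fin n) (Fin n) ℂ => (star v ⬝ᵥ M.mulVec v).re := by
      simp only [dotProduct, Matrix.mulVec]
      fun_prop
    exact h2.comp_continuousOn h1
  have hchord := le_chord_of_symmetric_second_derivative_nonneg hφc (fun τ hτ => ?_) hτ₀
  · simp only [hφ, one_smul, zero_smul, sub_self, sub_zero, add_zero, zero_add] at hchord
    rw [Matrix.sub_mulVec, Matrix.add_mulVec, Matrix.smul_mulVec, Matrix.smul_mulVec,
      dotProduct_sub, dotProduct_add, dotProduct_smul, dotProduct_smul, Complex.sub_re,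
      Complex.add_re, Complex.smul_re, Complex.smul_re, smul_eq_mul, smul_eq_mul]
    linarith
  · have hstep : ∀ h : ℝ, (τ • A + (1 - τ) • B) + h • (A - B) =
        (τ + h) • A + (1 - (τ + h)) • B := fun h => by module
    have hev : ∀ᶠ h : ℝ in 𝓝 0,
        spectrum ℝ ((τ • A + (1 - τ) • B) + h • (A - B)) ⊆ Icc a b := by
      have : Tendsto (fun h : ℝ => τ + h) (𝓝 0) (𝓝 τ) := by
        simpa using (continuous_const_add τ).tendsto 0
      filter_upwards [this.eventually (Icc_mem_nhds hτ.1 hτ.2)] with h hh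
      rw [hstep]
      exact hspec _ hh
    obtain ⟨L, hL, hlim⟩ := exists_symmetric_second_derivative_nonneg hIo hI isCompact_Icc hSI hf
      hK (hpath τ) (hA.sub hB) hev v
    refine ⟨L, hL, hlim.congr fun h => ?_⟩
    rw [hstep, hstep, ← sub_eq_add_neg]

/-- Near `t₀` the matrices `M_n` are entrywise close to the positive definite Hankel matrix, so that
all Kraus matrices with points near `t₀` are positive semidefinite. -/
theorem exists_isMatrixConvexOn_of_posDef_hankelK {n : ℕ} {I : Set ℝ} (hIo : IsOpen I)
    (hI : I.OrdConnected) {f : ℝ → ℝ} (hf : ContDiffOn ℝ (2 * n : ℕ) f I) {t₀ : ℝ} (ht₀ : t₀ ∈ I)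
    (hK : (hankelK n f t₀).PosDef) :
    ∃ J : Set ℝ, IsOpen J ∧ J.OrdConnected ∧ t₀ ∈ J ∧ J ⊆ I ∧ IsMatrixConvexOn n J f := by
  rcases Nat.eq_zero_or_pos n with rfl | hn
  · refine ⟨I, hIo, hI, ht₀, subset_rfl, fun A B _ _ _ _ c _ => ?_⟩
    rw [Subsingleton.elim (_ - _ : Matrix (Fin 0) (Fin 0) ℂ) 0]
    exact .zero
  have hf2 : ContDiffOn ℝ 2 f I := hf.of_le (by exact_mod_cast (by omega : 2 ≤ 2 * n))
  obtain ⟨ε, hε, hnear⟩ := hK.exists_posSemidef_near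
  obtain ⟨δ, hδ, hsub, hM⟩ := exists_krausM_near hIo hI hf ht₀ hε
  have hconv : IsMatrixConvexOn n (Icc (t₀ - δ) (t₀ + δ)) f := by
    refine isMatrixConvexOn_of_posSemidef_krausMatrix hIo hI hsub hf2 fun t ht s hs => ?_
    have ht' : ∀ i < n, t (i + 1) ∈ I := fun i hi => hsub (ht i hi)
    exact posSemidef_krausMatrix hIo hI hf ht' (hsub hs)
      (hnear _ (isHermitian_krausM hIo hI hf ht' (hsub hs)) (hM t ht s hs))
  exact ⟨Ioo (t₀ - δ) (t₀ + δ), isOpen_Ioo, ordConnected_Ioo, ⟨by linarith, by linarith⟩,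
    Ioo_subset_Icc_self.trans hsub, fun A B hA hB hAs hBs =>
      hconv A B hA hB (hAs.trans Ioo_subset_Icc_self) (hBs.trans Ioo_subset_Icc_self)⟩

theorem theorem1p2 (n : ℕ) (I : Set ℝ) (hIopen : IsOpen I) (hIint : I.OrdConnected)
    (f : ℝ → ℝ) (hf : ContDiffOn ℝ ((2 * n : ℕ) : WithTop ℕ∞) f I) :
    (∀ t : ℕ → ℝ, (∀ i ∈ Finset.Icc 1 n, t i ∈ I) → ∀ s ∈ I, ∀ r ∈ Finset.Icc 1 n,
      krausDet f t r s = (krausM f t r s).det *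
        ∏ k ∈ Finset.Icc 1 (r - 1), ∏ l ∈ Finset.Icc 1 (r - k), (t (k + l) - t l) ^ 2) ∧
    (IsMatrixConvexOn n I f → ∀ t ∈ I, (hankelK n f t).PosSemidef) ∧
    (∀ t₀ ∈ I, (hankelK n f t₀).PosDef →
      ∃ J : Set ℝ, IsOpen J ∧ J.OrdConnected ∧ t₀ ∈ J ∧ J ⊆ I ∧ IsMatrixConvexOn n J f) := by
  refine ⟨fun t ht s hs r hr => ?_, fun hconv t ht => hconv.posSemidef_hankelK hIopen hIint hf ht,
    fun t₀ ht₀ hK => exists_isMatrixConvexOn_of_posDef_hankelK hIopen hIint hf ht₀ hK⟩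
  rw [Finset.mem_Icc] at hr
  exact krausDet_eq hIopen hIint (hf.of_le (by exact_mod_cast (by omega : 2 * r ≤ 2 * n)))
    (fun i hi => ht (i + 1) (Finset.mem_Icc.mpr ⟨by omega, by omega⟩)) hs
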